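/- Let $M=(M_p)_{p\ge 0}$ be a strongly regular sequence: positive real numbers with $M_0=1$ such that * $M_p^2\le M_{p-1}M_{p+1}$ for all $p\ge 1$; * there is $A>0$ with $M_{p+\ell}\le A^{p+\ell}M_pM_\ell$ for all $p,\ell\ge 0$; * there is $B>0$ with $\sum_{\ell\ge p}\frac{M_\ell}{(\ell+1)M_{\ell+1}}\le B\,\frac{M_p}{M_{p+1}}$ for all $p\ge 0$ (in particular the series converge). Let $\gamma(M)$ be its growth index, i.e. the supremum of all $\gamma>0$ for which there are a real sequence $(m'_p)_{p\ge0}$ and $a\ge 1$ such that $a^{-1}M_{p+1}/M_p\le m'_p\le a\,M_{p+1}/M_p$ for all $p\ge 1$ and $\big((p+1)^{-\gamma}m'_p\big)_{p\ge 0}$ is increasing. Put $h_M(t)=\inf_{p\ge 0}M_pt^p$ for $t\ge 0$, and $M^s=(M_p^s)_{p\ge 0}$. Let $0<\delta<\delta_1<\gamma(M)$ and let $s$ satisfy $s\delta_1<1<s\gamma(M)$. On the sector $|\arg z|<\delta_1\pi/2$ of the Riemann surface of the logarithm put $$G_M(z)=\exp\Big(\frac1\pi\int_{-\infty}^{\infty}\log\big(h_{M^s}(|t|)\big)\,\frac{itz^s-1}{it-z^s}\,\frac{dt}{1+t^2}\Big),$$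 and let $e_M(z)=z\,G_M(1/z)$ for $|\arg z|<\delta\pi/2$. Then for every integer $p\ge 0$ the integral $$m(p)=\int_0^\infty t^{p-1}e_M(t)\,dt$$ converges absolutely and is a positive real number, and the sequence $(m(p))_{p\ge0}$ is equivalent to $M$ in the following sense: there are constants $L,H>0$ with $$L^pM_p\le m(p)\le H^pM_p\qquad\text{for all } p\ge 1,$$ and there are constants $C_1,C_2,C_3,C_4>0$ with $$C_3C_4^p\,M_p\le m(p)\le C_1C_2^p\,M_p\qquad\text{for all } p\ge 0.$$ -/

import Mathlib

noncomputable section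

/-- A sequence `M = (M_p)_{p ≥ 0}` of positive reals with `M_0 = 1` is strongly regular if it is
logarithmically convex, of moderate growth, and strongly non-quasianalytic.  In the last condition
the convergence of the series is part of the requirement. -/
structure StronglyRegular (M : ℕ → ℝ) : Prop where
  pos : ∀ p, 0 < M p
  zero : M 0 = 1
  logConvex : ∀ p, 1 ≤ p → M p ^ 2 ≤ M (p - 1) * M (p + 1)
  moderateGrowth : ∃ A : ℝ, 0 < A ∧ ∀ p l, M (p + l) ≤ A ^ (p + l) * M p * M l
  strongNonQuasianalytic : ∃ B : ℝ, 0 < B ∧ ∀ p,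
    Summable (fun l : ℕ => M (p + l) / (((p + l : ℕ) + 1 : ℝ) * M (p + l + 1))) ∧
      ∑' l : ℕ, M (p + l) / (((p + l : ℕ) + 1 : ℝ) * M (p + l + 1)) ≤ B * (M p / M (p + 1))

/-- The sequence of quotients `m_p = M_{p+1} / M_p`. -/
def quotientSeq (M : ℕ → ℝ) (p : ℕ) : ℝ := M (p + 1) / M p

/-- Property `(P_γ)`, for `γ > 0`: the quotients of `M` are comparable (for `p ≥ 1`) to a real
sequence `m'` such that `(p + 1)^{-γ} m'_p` is increasing. -/
def PropertyP (M : ℕ → ℝ) (γ : ℝ) : Prop :=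
  0 < γ ∧ ∃ (m' : ℕ → ℝ) (a : ℝ), 1 ≤ a ∧
    (∀ p, 1 ≤ p → a⁻¹ * quotientSeq M p ≤ m' p ∧ m' p ≤ a * quotientSeq M p) ∧
    Monotone (fun p : ℕ => ((p : ℝ) + 1) ^ (-γ) * m' p)

/-- The growth index `γ(M) = sup {γ : (P_γ) holds}`; for a strongly regular `M` the set is
nonempty and bounded above. -/
def growthIndex (M : ℕ → ℝ) : ℝ := sSup {γ : ℝ | PropertyP M γ}

/-- `h_M(t) = inf_p M_p t^p` for `t ≥ 0` (for `t = 0` the infimum is `0`). -/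
def hFun (M : ℕ → ℝ) (t : ℝ) : ℝ := ⨅ p : ℕ, M p * t ^ p

/-- The Riemann surface of the logarithm, a point `z` being recorded by its logarithm
`log |z| + i arg z`, which is an arbitrary complex number. -/
@[ext] structure LogSurface where
  log : ℂ

namespace LogSurface

/-- The projection to `ℂ`. -/
def toComplex (z : LogSurface) : ℂ := Complex.exp z.log

/-- The real power `z^s`, as a complex number. -/
def rpow (z : LogSurface) (s : ℝ) : ℂ := Complex.exp (s * z.log)

/-- The point `1 / z`. -/
def inv (z : LogSurface) : LogSurface := ⟨-z.log⟩

/-- The point with modulus `t > 0` and argument `0`. -/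
def ofPos (t : ℝ) : LogSurface := ⟨(Real.log t : ℂ)⟩

end LogSurface

/-- The flat function
`G_M(z) = exp ((1/π) ∫_ℝ log h_{M^s}(|t|) * (i t z^s - 1) / (i t - z^s) dt / (1 + t²))`,
where `M^s = (M_p^s)_p`.  It is meant for `z` in a sector `|arg z| < δ₁ π / 2` with
`s δ₁ < 1 < s γ(M)`. -/
def flatG (M : ℕ → ℝ) (s : ℝ) (z : LogSurface) : ℂ :=
  Complex.exp ((1 / Real.pi : ℂ) *
    ∫ t : ℝ, (Real.log (hFun (fun p => M p ^ s) |t|) : ℂ) *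
      ((Complex.I * t * z.rpow s - 1) / (Complex.I * t - z.rpow s)) * (1 / (1 + (t : ℂ) ^ 2)))

/-- `e_M(z) = z G_M(1/z)`. -/
def kernelE (M : ℕ → ℝ) (s : ℝ) (z : LogSurface) : ℂ :=
  z.toComplex * flatG M s z.inv

/-- The integrand `t^{lam - 1} e_M(t)` of the moment function. -/
def momentIntegrand (M : ℕ → ℝ) (s : ℝ) (lam : ℂ) (t : ℝ) : ℂ :=
  (t : ℂ) ^ (lam - 1) * kernelE M s (LogSurface.ofPos t)

/-- The moment function `m(lam) = ∫_0^∞ t^{lam - 1} e_M(t) dt`. -/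
def momentFun (M : ℕ → ℝ) (s : ℝ) (lam : ℂ) : ℂ :=
  ∫ t in Set.Ioi (0 : ℝ), momentIntegrand M s lam t

end

/-! Since `t^(p-1) e_M(t) = t^p G_M(1/t)`, only `G_M` on the positive half-line matters. There `w =
z^s` is positive, and folding `t` with `-t` turns the Schwarz integral into a Poisson integral: with
`N = M^s`, `G_M(x) = exp(-(2/π) P(x^s))` and `P(w) = ∫_0^∞ -log h_N(wu) / (1+u²) du`
(`integral_log_hFun_mul_schwarzKernel`).

The heart is that `P(w)` is comparable to `-log h_N` near `w`. From below, monotonicity on `u ≤ 1`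
suffices (`le_poissonWeight`). From above, `sγ(M) > 1` makes the quotients of `N` grow at least like
a power `β > 1`, so `-log h_N(uw)` grows at most like `u^(-η)` with `η < 1` as `u → 0`, which is
integrable (`exists_neg_log_hFun_le`).

Exponentiating bounds `G_M` by powers of dilates of `h_M`; moderate growth trades powers for
dilates, so `k h_M(c₂x) ≤ G_M(x) ≤ h_M(c₁x)` (`exists_hFun_le_exp_poissonWeight`). Such bounds force
moments comparable to `M` (`exists_moment_bounds`). -/

open MeasureTheory Set

/-! ### The associated function: where its infimum is attained, powers versus dilates. -/

section AssociatedFunction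

variable {N : ℕ → ℝ}

theorem hFun_bddBelow (hN : ∀ p, 0 < N p) {t : ℝ} (ht : 0 ≤ t) :
    BddBelow (range fun p : ℕ => N p * t ^ p) :=
  ⟨0, by rintro _ ⟨p, rfl⟩; exact mul_nonneg (hN p).le (pow_nonneg ht p)⟩

theorem hFun_le (hN : ∀ p, 0 < N p) {t : ℝ} (ht : 0 ≤ t) (p : ℕ) : hFun N t ≤ N p * t ^ p :=
  ciInf_le (hFun_bddBelow hN ht) p

theorem hFun_nonneg (hN : ∀ p, 0 < N p) {t : ℝ} (ht : 0 ≤ t) : 0 ≤ hFun N t :=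
  le_ciInf fun p => mul_nonneg (hN p).le (pow_nonneg ht p)

theorem hFun_mono (hN : ∀ p, 0 < N p) {x y : ℝ} (hx : 0 ≤ x) (hxy : x ≤ y) :
    hFun N x ≤ hFun N y :=
  le_ciInf fun p => (hFun_le hN hx p).trans
    (mul_le_mul_of_nonneg_left (pow_le_pow_left₀ hx hxy p) (hN p).le)

theorem hFun_le_one (hN : ∀ p, 0 < N p) (h0 : N 0 = 1) {t : ℝ} (ht : 0 ≤ t) : hFun N t ≤ 1 := by
  simpa [h0] using hFun_le hN ht 0

theorem measurable_hFun : Measurable (hFun N) := by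
  unfold hFun
  exact Measurable.iInf fun p => by fun_prop

theorem quotientSeq_pos (hN : ∀ p, 0 < N p) (p : ℕ) : 0 < quotientSeq N p :=
  div_pos (hN _) (hN _)

theorem mul_pow_succ_eq (hN : ∀ p, 0 < N p) (t : ℝ) (p : ℕ) :
    N (p + 1) * t ^ (p + 1) = N p * t ^ p * (quotientSeq N p * t) := by
  have := (hN p).ne'
  unfold quotientSeq
  field_simp
  ring

/-- If the quotients cross `1 / t` at the index `q`, then the infimum defining `h_N(t)` is attained
at `q`. -/
theorem hFun_eq_of_quotientSeq (hN : ∀ p, 0 < N p) (hmono : Monotone (quotientSeq N)) {t : ℝ}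
    (ht : 0 < t) {q : ℕ} (hlt : ∀ j < q, quotientSeq N j * t ≤ 1)
    (hge : 1 ≤ quotientSeq N q * t) : hFun N t = N q * t ^ q := by
  refine le_antisymm (hFun_le hN ht.le q) (le_ciInf fun p => ?_)
  have hpos : ∀ p, 0 < N p * t ^ p := fun p => mul_pos (hN p) (pow_pos ht p)
  rcases le_total q p with h | h
  · induction p, h using Nat.le_induction with
    | base => exact le_rfl
    | succ p hqp ih =>
      rw [mul_pow_succ_eq hN]
      refine ih.trans (le_mul_of_one_le_right (hpos p).le (hge.trans ?_))
      exact mul_le_mul_of_nonneg_right (hmono hqp) ht.le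
  · induction h using Nat.decreasingInduction with
    | self => exact le_rfl
    | of_succ p hpq ih =>
      refine ih.trans ?_
      rw [mul_pow_succ_eq hN]
      exact mul_le_of_le_one_right (hpos p).le (hlt p hpq)

/-- Telescoping, with `N 0 = 1`; this reduces estimates of `log h_N` to estimates of single
quotients. -/
theorem log_mul_pow_eq_sum (hN : ∀ p, 0 < N p) (h0 : N 0 = 1) {t : ℝ} (ht : 0 < t) (q : ℕ) :
    Real.log (N q * t ^ q) = ∑ j ∈ Finset.range q, Real.log (quotientSeq N j * t) := by
  induction q with
  | zero => simp [h0]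
  | succ q ih =>
    rw [Finset.sum_range_succ, ← ih, mul_pow_succ_eq hN,
      Real.log_mul (mul_pos (hN q) (pow_pos ht q)).ne'
        (mul_pos (quotientSeq_pos hN q) ht).ne']

theorem hFun_rpow (hN : ∀ p, 0 < N p) {s t : ℝ} (hs : 0 < s) (ht : 0 < t) :
    hFun (fun p => N p ^ s) (t ^ s) = hFun N t ^ s := by
  have hNs : ∀ p, 0 < N p ^ s := fun p => Real.rpow_pos_of_pos (hN p) s
  have hterm : ∀ p : ℕ, N p ^ s * (t ^ s) ^ p = (N p * t ^ p) ^ s := fun p => by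
    rw [Real.mul_rpow (hN p).le (pow_nonneg ht.le p), ← Real.rpow_natCast, ← Real.rpow_natCast,
      ← Real.rpow_mul ht.le, ← Real.rpow_mul ht.le, mul_comm s]
  have hts : (0 : ℝ) ≤ t ^ s := (Real.rpow_pos_of_pos ht s).le
  apply le_antisymm
  · have h1 : hFun (fun p => N p ^ s) (t ^ s) ^ s⁻¹ ≤ hFun N t := le_ciInf fun p => by
      rw [Real.rpow_inv_le_iff_of_pos (hFun_nonneg hNs hts)
        (mul_nonneg (hN p).le (pow_nonneg ht.le p)) hs, ← hterm]
      exact hFun_le hNs hts p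
    rwa [Real.rpow_inv_le_iff_of_pos (hFun_nonneg hNs hts) (hFun_nonneg hN ht.le) hs] at h1
  · refine le_ciInf fun p => ?_
    simp only [hterm]
    exact Real.rpow_le_rpow (hFun_nonneg hN ht.le) (hFun_le hN ht.le p) hs.le

/-- Only even indices are tested: moderate growth splits `N (2p)` into a square, at the cost of the
dilation `A`. -/
theorem hFun_le_sq (hN : ∀ p, 0 < N p) {A : ℝ} (hA : 0 < A)
    (hmg : ∀ p l, N (p + l) ≤ A ^ (p + l) * N p * N l) {t : ℝ} (ht : 0 ≤ t) :
    hFun N t ≤ hFun N (A * t) ^ 2 := by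
  have hAt : 0 ≤ A * t := mul_nonneg hA.le ht
  have h1 : √(hFun N t) ≤ hFun N (A * t) := le_ciInf fun p => by
    rw [Real.sqrt_le_left (mul_nonneg (hN p).le (pow_nonneg hAt p))]
    calc hFun N t ≤ N (p + p) * t ^ (p + p) := hFun_le hN ht _
      _ ≤ (A ^ (p + p) * N p * N p) * t ^ (p + p) :=
        mul_le_mul_of_nonneg_right (hmg p p) (pow_nonneg ht _)
      _ = (N p * (A * t) ^ p) ^ 2 := by ring
  rwa [Real.sqrt_le_left (hFun_nonneg hN hAt)] at h1

theorem hFun_le_pow_two_pow (hN : ∀ p, 0 < N p) {A : ℝ} (hA : 0 < A)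
    (hmg : ∀ p l, N (p + l) ≤ A ^ (p + l) * N p * N l) (k : ℕ) {t : ℝ} (ht : 0 ≤ t) :
    hFun N t ≤ hFun N (A ^ k * t) ^ (2 ^ k) := by
  induction k generalizing t with
  | zero => simp
  | succ k ih =>
    have hAt : 0 ≤ A * t := mul_nonneg hA.le ht
    calc hFun N t ≤ hFun N (A * t) ^ 2 := hFun_le_sq hN hA hmg ht
      _ ≤ (hFun N (A ^ k * (A * t)) ^ (2 ^ k)) ^ 2 :=
        pow_le_pow_left₀ (hFun_nonneg hN hAt) (ih hAt) 2
      _ = _ := by rw [← pow_mul, ← pow_succ, ← mul_assoc, ← pow_succ]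

/-- Small positive powers of `h_N` are dominated by a dilate of `h_N`. -/
theorem exists_hFun_rpow_le (hN : ∀ p, 0 < N p) (h0 : N 0 = 1) {A : ℝ} (hA : 0 < A)
    (hmg : ∀ p l, N (p + l) ≤ A ^ (p + l) * N p * N l) {r : ℝ} (hr : 0 < r) :
    ∃ c : ℝ, 0 < c ∧ ∀ t, 0 ≤ t → hFun N t ^ r ≤ hFun N (c * t) := by
  -- With `2^k r ≥ 1`, lowering the exponent to `1` increases the power, because `h_N ≤ 1`.
  obtain ⟨k, hk⟩ := pow_unbounded_of_one_lt r⁻¹ (one_lt_two (α := ℝ))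
  refine ⟨A ^ k, pow_pos hA k, fun t ht => ?_⟩
  have hAt : 0 ≤ A ^ k * t := mul_nonneg (pow_pos hA k).le ht
  have hh := hFun_nonneg hN hAt
  calc hFun N t ^ r ≤ (hFun N (A ^ k * t) ^ (2 ^ k)) ^ r :=
        Real.rpow_le_rpow (hFun_nonneg hN ht) (hFun_le_pow_two_pow hN hA hmg k ht) hr.le
    _ = hFun N (A ^ k * t) ^ ((2 : ℝ) ^ k * r) := by
        rw [Real.rpow_mul hh]; norm_cast
    _ ≤ hFun N (A ^ k * t) ^ (1 : ℝ) := by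
        refine Real.rpow_le_rpow_of_exponent_ge' hh (hFun_le_one hN h0 hAt) zero_le_one ?_
        rw [inv_lt_iff_one_lt_mul₀ hr] at hk
        exact hk.le.trans_eq (by ring)
    _ = _ := Real.rpow_one _

/-- Large powers of `h_N` dominate a dilate of `h_N`. -/
theorem exists_hFun_le_rpow (hN : ∀ p, 0 < N p) (h0 : N 0 = 1) {A : ℝ} (hA : 0 < A)
    (hmg : ∀ p l, N (p + l) ≤ A ^ (p + l) * N p * N l) {r : ℝ} (hr : 0 ≤ r) :
    ∃ c : ℝ, 0 < c ∧ ∀ t, 0 ≤ t → hFun N (c * t) ≤ hFun N t ^ r := by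
  obtain ⟨k, hk⟩ := pow_unbounded_of_one_lt r (one_lt_two (α := ℝ))
  have hAk := pow_pos hA k
  refine ⟨(A ^ k)⁻¹, inv_pos.2 hAk, fun t ht => ?_⟩
  have h1 := hFun_le_pow_two_pow hN hA hmg k (mul_nonneg (inv_pos.2 hAk).le ht)
  rw [mul_inv_cancel_left₀ hAk.ne'] at h1
  refine h1.trans ?_
  calc hFun N t ^ (2 ^ k) = hFun N t ^ ((2 : ℝ) ^ k) := by
        rw [← Real.rpow_natCast]; norm_cast
    _ ≤ hFun N t ^ r :=
        Real.rpow_le_rpow_of_exponent_ge' (hFun_nonneg hN ht) (hFun_le_one hN h0 ht) hr hk.le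

end AssociatedFunction

/-! ### Power growth of the quotients and its effect on `-log h_N`. -/

section Growth

/-- Passing to `m'` and back costs `a` twice. The comparison with `m'` starts at index `1`, so `p =
0` goes through the quotient at `1`, which costs the factor `2^(-γ)`. -/
theorem PropertyP.exists_quotientSeq_le {M : ℕ → ℝ} (hM : ∀ p, 0 < M p)
    (hmono : Monotone (quotientSeq M)) {γ : ℝ} (h : PropertyP M γ) :
    ∃ c : ℝ, 0 < c ∧ ∀ p q : ℕ, p ≤ q →
      c * (((q : ℝ) + 1) / (p + 1)) ^ γ * quotientSeq M p ≤ quotientSeq M q := by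
  obtain ⟨hγ, m', a, ha, hm, hinc⟩ := h
  have ha0 : 0 < a := by linarith
  have key : ∀ p q : ℕ, 1 ≤ p → p ≤ q →
      a⁻¹ ^ 2 * (((q : ℝ) + 1) / (p + 1)) ^ γ * quotientSeq M p ≤ quotientSeq M q := by
    intro p q hp hpq
    have h1 := (hm p hp).1
    have h2 := (hm q (hp.trans hpq)).2
    have h3 := hinc hpq
    simp only at h3
    have hp0 : (0 : ℝ) < (p : ℝ) + 1 := by positivity
    have hq0 : (0 : ℝ) < (q : ℝ) + 1 := by positivity
    rw [Real.rpow_neg hp0.le, Real.rpow_neg hq0.le] at h3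
    have hpγ := Real.rpow_pos_of_pos hp0 γ
    have hqγ := Real.rpow_pos_of_pos hq0 γ
    rw [Real.div_rpow hq0.le hp0.le]
    set P := ((p : ℝ) + 1) ^ γ
    set Q := ((q : ℝ) + 1) ^ γ
    have h4 : Q / P * m' p ≤ m' q := by
      have := mul_le_mul_of_nonneg_left h3 hqγ.le
      rw [mul_inv_cancel_left₀ hqγ.ne'] at this
      exact (by rw [div_eq_mul_inv, mul_assoc] : Q / P * m' p = _).trans_le this
    calc a⁻¹ ^ 2 * (Q / P) * quotientSeq M p
        = a⁻¹ * (Q / P * (a⁻¹ * quotientSeq M p)) := by ring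
      _ ≤ a⁻¹ * (Q / P * m' p) := by gcongr
      _ ≤ a⁻¹ * (a * quotientSeq M q) := mul_le_mul_of_nonneg_left (h4.trans h2) (inv_pos.2 ha0).le
      _ = quotientSeq M q := inv_mul_cancel_left₀ ha0.ne' _
  have h2γ : (0 : ℝ) < 2 ^ γ := Real.rpow_pos_of_pos two_pos γ
  have h2γ1 : ((2 : ℝ) ^ γ)⁻¹ ≤ 1 := inv_le_one_of_one_le₀ (Real.one_le_rpow one_le_two hγ.le)
  have ha1 : a⁻¹ ^ 2 ≤ 1 := pow_le_one₀ (by positivity) (inv_le_one_of_one_le₀ ha)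
  refine ⟨a⁻¹ ^ 2 * ((2 : ℝ) ^ γ)⁻¹, by positivity, fun p q hpq => ?_⟩
  have hmp := quotientSeq_pos hM
  rcases Nat.eq_zero_or_pos p with rfl | hp
  · rcases Nat.eq_zero_or_pos q with rfl | hq
    · simpa using mul_le_of_le_one_left (hmp 0).le (mul_le_one₀ ha1 (by positivity) h2γ1)
    · refine le_trans ?_ (key 1 q le_rfl hq)
      have : (((q : ℝ) + 1) / (((1 : ℕ) : ℝ) + 1)) ^ γ = ((2 : ℝ) ^ γ)⁻¹ * ((q : ℝ) + 1) ^ γ := by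
        rw [Real.div_rpow (by positivity) (by positivity)]
        norm_num
        ring
      rw [this, ← mul_assoc]
      have h01 : quotientSeq M 0 ≤ quotientSeq M 1 := hmono zero_le_one
      simp only [Nat.cast_zero, zero_add, div_one]
      gcongr
  · refine le_trans ?_ (key p q hp hpq)
    have := (hmp p).le
    gcongr
    exact mul_le_of_le_one_right (by positivity) h2γ1

/-- Comparison with the integral of `x^(-κ)` from `k`; the term `i = 0` equals `1` and is absorbed
by `1 ≤ k`. -/
theorem sum_div_add_rpow_le {κ k : ℝ} (hκ : 1 < κ) (hk : 1 ≤ k) (q : ℕ) :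
    ∑ i ∈ Finset.range q, (k / (k + i)) ^ κ ≤ (1 + 1 / (κ - 1)) * k := by
  have hk0 : 0 < k := by linarith
  have hkκ := Real.rpow_pos_of_pos hk0 κ
  have hanti : AntitoneOn (fun x : ℝ => x ^ (-κ)) (Icc k (k + q)) := fun x hx y _ hxy =>
    Real.rpow_le_rpow_of_nonpos (hk0.trans_le hx.1) hxy (by linarith)
  have h1 := hanti.sum_le_integral
  have hkq : 0 < k + q := by positivity
  rw [integral_rpow (Or.inr ⟨by linarith, by
    rw [uIcc_of_le (by linarith [q.cast_nonneg (α := ℝ)])]; exact fun h => absurd h.1 (by linarith)⟩)]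
    at h1
  have h2 : ((k + q) ^ (-κ + 1) - k ^ (-κ + 1)) / (-κ + 1) ≤ k ^ (-κ + 1) / (κ - 1) := by
    rw [← neg_div_neg_eq, show -(-κ + 1) = κ - 1 by ring]
    have := Real.rpow_pos_of_pos hkq (-κ + 1)
    exact div_le_div_of_nonneg_right (by linarith) (by linarith)
  have hterm : ∀ i : ℕ, (k / (k + i)) ^ κ = k ^ κ * (k + i) ^ (-κ) := fun i => by
    rw [Real.div_rpow hk0.le (by positivity), Real.rpow_neg (by positivity), div_eq_mul_inv]
  calc ∑ i ∈ Finset.range q, (k / (k + i)) ^ κ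
      ≤ ∑ i ∈ Finset.range (q + 1), (k / (k + i)) ^ κ :=
        Finset.sum_le_sum_of_subset_of_nonneg (Finset.range_mono q.le_succ)
          fun i _ _ => by positivity
    _ = k ^ κ * ∑ i ∈ Finset.range q, (k + ((i + 1 : ℕ) : ℝ)) ^ (-κ) + 1 := by
        rw [Finset.sum_range_succ', Finset.mul_sum]
        congr 1
        · exact Finset.sum_congr rfl fun i _ => hterm _
        · simp [hk0.ne']
    _ ≤ k ^ κ * (k ^ (-κ + 1) / (κ - 1)) + 1 := by gcongr; exact h1.trans h2
    _ = k / (κ - 1) + 1 := by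
        rw [← mul_div_assoc, ← Real.rpow_add hk0]
        simp
    _ ≤ (1 + 1 / (κ - 1)) * k := by
        rw [add_mul, one_mul, one_div_mul_eq_div]
        linarith

variable {N : ℕ → ℝ}

theorem exists_lt_quotientSeq_mul (hN : ∀ p, 0 < N p) {c β : ℝ} (hβ : 1 < β) (hc : 0 < c)
    (hg : ∀ p q : ℕ, p ≤ q →
      c * (((q : ℝ) + 1) / (p + 1)) ^ β * quotientSeq N p ≤ quotientSeq N q)
    {t : ℝ} (ht : 0 < t) : ∃ q, 1 < quotientSeq N q * t := by
  have hn0 := quotientSeq_pos hN 0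
  obtain ⟨q, hq⟩ := exists_nat_gt (1 / (c * quotientSeq N 0 * t))
  refine ⟨q, ?_⟩
  rw [div_lt_iff₀ (by positivity)] at hq
  have h1 := hg 0 q q.zero_le
  simp only [Nat.cast_zero, zero_add, div_one] at h1
  have h2 : (q : ℝ) ≤ ((q : ℝ) + 1) ^ β := by
    have : ((q : ℝ) + 1) ^ (1 : ℝ) ≤ ((q : ℝ) + 1) ^ β :=
      Real.rpow_le_rpow_of_exponent_le (by linarith [q.cast_nonneg (α := ℝ)]) hβ.le
    rw [Real.rpow_one] at this
    linarith
  calc 1 < q * (c * quotientSeq N 0 * t) := hq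
    _ ≤ ((q : ℝ) + 1) ^ β * (c * quotientSeq N 0 * t) := by gcongr
    _ = c * ((q : ℝ) + 1) ^ β * quotientSeq N 0 * t := by ring
    _ ≤ _ := by gcongr

theorem exists_hFun_eq (hN : ∀ p, 0 < N p) (hmono : Monotone (quotientSeq N)) {c β : ℝ}
    (hβ : 1 < β) (hc : 0 < c)
    (hg : ∀ p q : ℕ, p ≤ q →
      c * (((q : ℝ) + 1) / (p + 1)) ^ β * quotientSeq N p ≤ quotientSeq N q)
    {t : ℝ} (ht : 0 < t) :
    ∃ q, hFun N t = N q * t ^ q ∧ (∀ j < q, quotientSeq N j * t ≤ 1) ∧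
      1 < quotientSeq N q * t := by
  classical
  have hex := exists_lt_quotientSeq_mul hN hβ hc hg ht
  refine ⟨Nat.find hex, hFun_eq_of_quotientSeq hN hmono ht ?_ (Nat.find_spec hex).le, ?_,
    Nat.find_spec hex⟩ <;> exact fun j hj => not_lt.1 (Nat.find_min hex hj)

theorem hFun_pos (hN : ∀ p, 0 < N p) (hmono : Monotone (quotientSeq N)) {c β : ℝ}
    (hβ : 1 < β) (hc : 0 < c)
    (hg : ∀ p q : ℕ, p ≤ q →
      c * (((q : ℝ) + 1) / (p + 1)) ^ β * quotientSeq N p ≤ quotientSeq N q)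
    {t : ℝ} (ht : 0 < t) : 0 < hFun N t := by
  obtain ⟨q, hq, -⟩ := exists_hFun_eq hN hmono hβ hc hg ht
  rw [hq]
  exact mul_pos (hN q) (pow_pos ht q)

/-- Sublinear growth of `-log h_N` under contraction of the argument, for a sequence whose quotients
grow at least like a power `β > 1`. -/
theorem exists_neg_log_hFun_le (hN : ∀ p, 0 < N p) (h0 : N 0 = 1)
    (hmono : Monotone (quotientSeq N)) {c β : ℝ} (hβ : 1 < β) (hc : 0 < c)
    (hg : ∀ p q : ℕ, p ≤ q →
      c * (((q : ℝ) + 1) / (p + 1)) ^ β * quotientSeq N p ≤ quotientSeq N q) :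
    ∃ η C : ℝ, 0 < η ∧ η < 1 ∧ 0 < C ∧ ∀ t u : ℝ, 0 < t → 0 < u → u ≤ 1 →
      -Real.log (hFun N (u * t)) ≤
        C * u ^ (-η) * (1 + -Real.log (hFun N (Real.exp (-1) * t))) := by
  -- `η > 1/β` makes the tail sum over `j ≥ ν` converge; `η < 1` keeps `u^(-η)` integrable at `0`.
  obtain ⟨η, hη1, hη2⟩ := exists_between (inv_lt_one_of_one_lt₀ hβ)
  have hβ0 : 0 < β := by linarith
  have hη : 0 < η := (inv_pos.2 hβ0).trans hη1
  have hκ : 1 < β * η := by rwa [inv_lt_iff_one_lt_mul₀ hβ0, mul_comm] at hη1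
  set D := 1 + 1 / (β * η - 1) with hD
  have hD0 : 0 < D := by
    have : 0 < β * η - 1 := by linarith
    positivity
  have hcη := Real.rpow_pos_of_pos hc (-η)
  refine ⟨η, 1 + 1 / η + c ^ (-η) / η * D, hη, hη2, by positivity, fun t u ht hu hu1 => ?_⟩
  -- The infimum is attained at `q` for `u t` and at `ν` for `t`.
  obtain ⟨q, hq, -⟩ := exists_hFun_eq hN hmono hβ hc hg (mul_pos hu ht)
  obtain ⟨ν, -, hν, hν'⟩ := exists_hFun_eq hN hmono hβ hc hg ht
  have het : 0 < Real.exp (-1) * t := mul_pos (Real.exp_pos _) ht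
  have hn := quotientSeq_pos hN
  have hu1' : 1 ≤ u ^ (-η) := Real.one_le_rpow_of_pos_of_le_one_of_nonpos hu hu1 (by linarith)
  have hu0 : 0 < u ^ (-η) := by linarith
  set Φ := -Real.log (hFun N (Real.exp (-1) * t)) with hΦ
  set S := ∑ j ∈ Finset.range ν, -Real.log (quotientSeq N j * t) with hS
  have hSterm : ∀ j < ν, 0 ≤ -Real.log (quotientSeq N j * t) := fun j hj =>
    neg_nonneg.2 (Real.log_nonpos (mul_pos (hn j) ht).le (hν j hj))
  have hS0 : 0 ≤ S := Finset.sum_nonneg fun j hj => hSterm j (Finset.mem_range.1 hj)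
  -- Testing the infimum at `t/e` with index `ν`: each of the `ν` factors contributes an extra `1`.
  -- This is why the dilation `exp (-1)` appears: it controls `ν` as well as `S`.
  have hSΦ : S + ν ≤ Φ := by
    have h1 : Real.log (hFun N (Real.exp (-1) * t)) ≤
        Real.log (N ν * (Real.exp (-1) * t) ^ ν) :=
      Real.log_le_log (hFun_pos hN hmono hβ hc hg het) (hFun_le hN het.le ν)
    rw [log_mul_pow_eq_sum hN h0 het] at h1
    have h2 : ∑ j ∈ Finset.range ν, Real.log (quotientSeq N j * (Real.exp (-1) * t)) =
        -(S + ν) := by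
      rw [hS, Finset.sum_neg_distrib]
      have : ∀ j, Real.log (quotientSeq N j * (Real.exp (-1) * t)) =
          Real.log (quotientSeq N j * t) - 1 := fun j => by
        rw [mul_left_comm, Real.log_mul (Real.exp_pos _).ne' (mul_pos (hn j) ht).ne',
          Real.log_exp]
        ring
      simp only [this, Finset.sum_sub_distrib, Finset.sum_const, Finset.card_range, nsmul_eq_mul]
      ring
    rw [hΦ]
    linarith
  -- A nonnegative majorant of each summand. Below `ν` the logarithm of `u` is split off; from `ν`
  -- on, the power growth enters. Both use `log x ≤ x^η / η`.
  set g : ℕ → ℝ := fun j => if j < ν then -Real.log (quotientSeq N j * t) + u ^ (-η) / η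
    else c ^ (-η) / η * u ^ (-η) * (((ν : ℝ) + 1) / (j + 1)) ^ (β * η) with hgdef
  have hlogu : -Real.log u ≤ u ^ (-η) / η := by
    have := Real.log_le_rpow_div (inv_pos.2 hu).le hη
    rwa [Real.log_inv, Real.inv_rpow hu.le, ← Real.rpow_neg hu.le] at this
  have hg0 : ∀ j, 0 ≤ g j := fun j => by
    simp only [hgdef]
    split_ifs with hj
    · have := hSterm j hj
      positivity
    · positivity
  have hterm : ∀ j, -Real.log (quotientSeq N j * (u * t)) ≤ g j := fun j => by
    simp only [hgdef]
    have hnt := mul_pos (hn j) ht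
    split_ifs with hj
    · rw [mul_left_comm, Real.log_mul hu.ne' hnt.ne']
      linarith
    · have hνj : ν ≤ j := not_lt.1 hj
      have hr : 0 < ((j : ℝ) + 1) / (ν + 1) := by positivity
      have hrβ := Real.rpow_pos_of_pos hr β
      have h1 : c * (((j : ℝ) + 1) / (ν + 1)) ^ β ≤ quotientSeq N j * t := by
        calc c * (((j : ℝ) + 1) / (ν + 1)) ^ β
            ≤ c * (((j : ℝ) + 1) / (ν + 1)) ^ β * (quotientSeq N ν * t) :=
              le_mul_of_one_le_right (by positivity) hν'.le
          _ = c * (((j : ℝ) + 1) / (ν + 1)) ^ β * quotientSeq N ν * t := by ring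
          _ ≤ _ := by gcongr; exact hg ν j hνj
      set y := u * (c * (((j : ℝ) + 1) / (ν + 1)) ^ β) with hy
      have hy0 : 0 < y := by positivity
      have h2 : y ≤ quotientSeq N j * (u * t) :=
        (mul_le_mul_of_nonneg_left h1 hu.le).trans_eq (mul_left_comm _ _ _)
      have h3 : -Real.log y ≤ y ^ (-η) / η := by
        have := Real.log_le_rpow_div (inv_pos.2 hy0).le hη
        rwa [Real.log_inv, Real.inv_rpow hy0.le, ← Real.rpow_neg hy0.le] at this
      have h4 : y ^ (-η) = u ^ (-η) * (c ^ (-η) * (((ν : ℝ) + 1) / (j + 1)) ^ (β * η)) := by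
        rw [hy, Real.mul_rpow hu.le (by positivity), Real.mul_rpow hc.le hrβ.le,
          ← Real.rpow_mul hr.le, mul_neg, Real.rpow_neg hr.le, ← Real.inv_rpow hr.le, inv_div]
      have h5 := Real.log_le_log hy0 h2
      refine (by linarith : _ ≤ y ^ (-η) / η).trans_eq ?_
      rw [h4]
      ring
  -- Summing up to `ν + q` instead of `q` avoids comparing `q` with `ν`.
  have hsum : ∑ j ∈ Finset.range (ν + q), g j ≤
      S + ν * (u ^ (-η) / η) + c ^ (-η) / η * u ^ (-η) * (D * (ν + 1)) := by
    rw [Finset.sum_range_add]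
    have e1 : ∑ j ∈ Finset.range ν, g j = S + ν * (u ^ (-η) / η) := by
      rw [Finset.sum_congr rfl fun j hj => if_pos (Finset.mem_range.1 hj),
        Finset.sum_add_distrib]
      simp [hS]
    have e2 : ∑ i ∈ Finset.range q, g (ν + i) = c ^ (-η) / η * u ^ (-η) *
        ∑ i ∈ Finset.range q, (((ν : ℝ) + 1) / (ν + 1 + i)) ^ (β * η) := by
      rw [Finset.mul_sum]
      refine Finset.sum_congr rfl fun i _ => ?_
      simp only [hgdef, if_neg (not_lt.2 (Nat.le_add_right ν i))]
      push_cast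
      rw [add_right_comm]
    rw [e1, e2]
    gcongr
    exact sum_div_add_rpow_le hκ (by linarith [ν.cast_nonneg (α := ℝ)]) q
  have hνΦ : (ν : ℝ) ≤ Φ := by linarith
  have hSΦ' : S ≤ Φ := by linarith [ν.cast_nonneg (α := ℝ)]
  have hΦ0 : 0 ≤ Φ := by linarith
  calc -Real.log (hFun N (u * t))
      = ∑ j ∈ Finset.range q, -Real.log (quotientSeq N j * (u * t)) := by
        rw [hq, log_mul_pow_eq_sum hN h0 (mul_pos hu ht), Finset.sum_neg_distrib]
    _ ≤ ∑ j ∈ Finset.range q, g j := Finset.sum_le_sum fun j _ => hterm j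
    _ ≤ ∑ j ∈ Finset.range (ν + q), g j :=
        Finset.sum_le_sum_of_subset_of_nonneg (Finset.range_mono (Nat.le_add_left q ν))
          fun j _ _ => hg0 j
    _ ≤ S + ν * (u ^ (-η) / η) + c ^ (-η) / η * u ^ (-η) * (D * (ν + 1)) := hsum
    _ ≤ u ^ (-η) * (1 + Φ) + (1 + Φ) * (u ^ (-η) / η) +
          c ^ (-η) / η * u ^ (-η) * (D * (1 + Φ)) := by
        have hS1 : S ≤ u ^ (-η) * (1 + Φ) :=
          (by linarith : S ≤ 1 * (1 + Φ)).trans (by gcongr)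
        have hν1 : (ν : ℝ) ≤ 1 + Φ := by linarith
        have hν2 : (ν : ℝ) + 1 ≤ 1 + Φ := by linarith
        exact add_le_add (add_le_add hS1 (by gcongr)) (by gcongr)
    _ = _ := by ring

end Growth

/-! ### The Poisson integral of `-log h_N` and the Schwarz kernel on the half-line. -/

section Poisson

theorem integrable_comp_abs {f : ℝ → ℝ} (hf : IntegrableOn f (Ioi 0)) :
    Integrable fun x => f |x| := by
  have h1 : IntegrableOn (fun x => f |x|) (Ioi 0) :=
    hf.congr_fun (fun x hx => by rw [abs_of_pos (mem_Ioi.1 hx)]) measurableSet_Ioi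
  have h2 : IntegrableOn (fun x => f |x|) (Iic 0) := by
    rw [← Measure.map_neg_eq_self (volume : Measure ℝ)]
    let m : MeasurableEmbedding fun x : ℝ => -x := (Homeomorph.neg ℝ).measurableEmbedding
    rw [m.integrableOn_map_iff]
    simp_rw [Function.comp_def, abs_neg, neg_preimage, neg_Iic, neg_zero]
    exact Iff.mpr integrableOn_Ici_iff_integrableOn_Ioi h1
  rw [← integrableOn_univ, ← Iic_union_Ioi (a := (0 : ℝ))]
  exact h2.union h1

theorem integrableOn_rpow_neg_add_one_mul {η : ℝ} (h0 : 0 < η) (h1 : η < 1) :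
    IntegrableOn (fun u : ℝ => (u ^ (-η) + 1) * (1 + u ^ 2)⁻¹) (Ioi 0) := by
  have hmeas : Measurable fun u : ℝ => (u ^ (-η) + 1) * (1 + u ^ 2)⁻¹ := by fun_prop
  rw [← Ioc_union_Ioi_eq_Ioi (zero_le_one (α := ℝ))]
  refine IntegrableOn.union ?_ ?_
  · have hi : IntegrableOn (fun u : ℝ => u ^ (-η) + 1) (Ioc 0 1) :=
      ((intervalIntegral.integrableOn_Ioo_rpow_iff one_pos).2 (by linarith)).congr_set_ae
        Ioo_ae_eq_Ioc.symm |>.add (integrableOn_const (by simp))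
    refine hi.mono' hmeas.aestronglyMeasurable ?_
    filter_upwards [ae_restrict_mem measurableSet_Ioc] with u hu
    have := hu.1
    rw [Real.norm_of_nonneg (by positivity)]
    exact mul_le_of_le_one_right (by positivity)
      (inv_le_one_of_one_le₀ (by nlinarith [sq_nonneg u]))
  · refine (integrable_inv_one_add_sq.integrableOn.const_mul 2).mono'
      hmeas.aestronglyMeasurable ?_
    filter_upwards [ae_restrict_mem measurableSet_Ioi] with u hu
    have hu1 : 1 < u := hu
    have hu0 : 0 < u := by linarith
    rw [Real.norm_of_nonneg (by positivity)]
    have : u ^ (-η) ≤ 1 := Real.rpow_le_one_of_one_le_of_nonpos hu1.le (by linarith)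
    gcongr
    linarith

/-- The Poisson integral of `-log h_N(|t|)` over the imaginary axis, at the point `w > 0` and up to
the factor `2 / π`. -/
noncomputable def poissonWeight (N : ℕ → ℝ) (w : ℝ) : ℝ :=
  ∫ u in Ioi (0 : ℝ), -Real.log (hFun N (w * u)) * (1 + u ^ 2)⁻¹

variable {N : ℕ → ℝ}

theorem neg_log_hFun_nonneg (hN : ∀ p, 0 < N p) (h0 : N 0 = 1) {t : ℝ} (ht : 0 ≤ t) :
    0 ≤ -Real.log (hFun N t) :=
  neg_nonneg.2 (Real.log_nonpos (hFun_nonneg hN ht) (hFun_le_one hN h0 ht))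

theorem measurable_poissonWeight : Measurable (poissonWeight N) := by
  refine (StronglyMeasurable.integral_prod_right (ν := volume.restrict (Ioi 0))
    (f := fun w u : ℝ => -Real.log (hFun N (w * u)) * (1 + u ^ 2)⁻¹)
    (Measurable.stronglyMeasurable ?_)).measurable
  have : Measurable fun x : ℝ × ℝ => hFun N (x.1 * x.2) := measurable_hFun.comp (by fun_prop)
  unfold Function.uncurry
  fun_prop

/-- A bound for `-log h_N (w u)` that is integrable in `u` against `1 / (1 + u ^ 2)`. -/
theorem exists_neg_log_hFun_mul_le (hN : ∀ p, 0 < N p) (h0 : N 0 = 1)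
    (hmono : Monotone (quotientSeq N)) {c β : ℝ} (hβ : 1 < β) (hc : 0 < c)
    (hg : ∀ p q : ℕ, p ≤ q →
      c * (((q : ℝ) + 1) / (p + 1)) ^ β * quotientSeq N p ≤ quotientSeq N q) :
    ∃ η C : ℝ, 0 < η ∧ η < 1 ∧ 0 < C ∧ ∀ w u : ℝ, 0 < w → 0 < u →
      -Real.log (hFun N (w * u)) ≤
        C * (1 + -Real.log (hFun N (Real.exp (-1) * w))) * (u ^ (-η) + 1) := by
  obtain ⟨η, C, hη, hη1, hC, h⟩ := exists_neg_log_hFun_le hN h0 hmono hβ hc hg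
  have hanti : ∀ x y : ℝ, 0 < x → x ≤ y → -Real.log (hFun N y) ≤ -Real.log (hFun N x) :=
    fun x y hx hxy => neg_le_neg <|
      Real.log_le_log (hFun_pos hN hmono hβ hc hg hx) (hFun_mono hN hx.le hxy)
  refine ⟨η, C, hη, hη1, hC, fun w u hw hu => ?_⟩
  have hΦ := neg_log_hFun_nonneg hN h0 (mul_pos (Real.exp_pos (-1)) hw).le
  have huη := Real.rpow_pos_of_pos hu (-η)
  set Φ := -Real.log (hFun N (Real.exp (-1) * w))
  rcases le_total u 1 with hu1 | hu1
  · have := h w u hw hu hu1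
    rw [mul_comm w u]
    refine this.trans ((by ring : _ = C * (1 + Φ) * u ^ (-η)).trans_le ?_)
    gcongr
    linarith
  · have h1 := h w 1 hw one_pos le_rfl
    have h2 := hanti w (w * u) hw (le_mul_of_one_le_right hw.le hu1)
    rw [one_mul, Real.one_rpow, mul_one] at h1
    exact h2.trans (h1.trans (le_mul_of_one_le_right (by positivity) (by linarith)))

theorem measurable_neg_log_hFun_mul (w : ℝ) :
    Measurable fun u : ℝ => -Real.log (hFun N (w * u)) * (1 + u ^ 2)⁻¹ := by
  have : Measurable fun u : ℝ => hFun N (w * u) := measurable_hFun.comp (by fun_prop)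
  fun_prop

theorem integrableOn_neg_log_hFun (hN : ∀ p, 0 < N p) (h0 : N 0 = 1)
    (hmono : Monotone (quotientSeq N)) {c β : ℝ} (hβ : 1 < β) (hc : 0 < c)
    (hg : ∀ p q : ℕ, p ≤ q →
      c * (((q : ℝ) + 1) / (p + 1)) ^ β * quotientSeq N p ≤ quotientSeq N q)
    {w : ℝ} (hw : 0 < w) :
    IntegrableOn (fun u : ℝ => -Real.log (hFun N (w * u)) * (1 + u ^ 2)⁻¹) (Ioi 0) := by
  obtain ⟨η, C, hη, hη1, hC, h⟩ := exists_neg_log_hFun_mul_le hN h0 hmono hβ hc hg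
  refine ((integrableOn_rpow_neg_add_one_mul hη hη1).const_mul
    (C * (1 + -Real.log (hFun N (Real.exp (-1) * w))))).mono'
    (measurable_neg_log_hFun_mul w).aestronglyMeasurable ?_
  filter_upwards [ae_restrict_mem measurableSet_Ioi] with u hu
  have hu0 : 0 < u := hu
  have := neg_log_hFun_nonneg hN h0 (mul_pos hw hu0).le
  rw [Real.norm_of_nonneg (by positivity), ← mul_assoc]
  exact mul_le_mul_of_nonneg_right (h w u hw hu0) (by positivity)

theorem exists_poissonWeight_le (hN : ∀ p, 0 < N p) (h0 : N 0 = 1)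
    (hmono : Monotone (quotientSeq N)) {c β : ℝ} (hβ : 1 < β) (hc : 0 < c)
    (hg : ∀ p q : ℕ, p ≤ q →
      c * (((q : ℝ) + 1) / (p + 1)) ^ β * quotientSeq N p ≤ quotientSeq N q) :
    ∃ K : ℝ, 0 ≤ K ∧ ∀ w : ℝ, 0 < w →
      poissonWeight N w ≤ K * (1 + -Real.log (hFun N (Real.exp (-1) * w))) := by
  obtain ⟨η, C, hη, hη1, hC, h⟩ := exists_neg_log_hFun_mul_le hN h0 hmono hβ hc hg
  refine ⟨C * ∫ u in Ioi (0 : ℝ), (u ^ (-η) + 1) * (1 + u ^ 2)⁻¹,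
    mul_nonneg hC.le (setIntegral_nonneg measurableSet_Ioi fun u hu => ?_), fun w hw => ?_⟩
  · have : 0 < u := hu
    positivity
  · rw [mul_right_comm, ← integral_const_mul]
    refine setIntegral_mono_on (integrableOn_neg_log_hFun hN h0 hmono hβ hc hg hw)
      ((integrableOn_rpow_neg_add_one_mul hη hη1).const_mul _) measurableSet_Ioi fun u hu => ?_
    rw [← mul_assoc]
    exact mul_le_mul_of_nonneg_right (h w u hw hu) (by positivity)

/-- Keep only `u ≤ 1`, where `-log h_N(wu) ≥ -log h_N(w)`; the factor is `arctan 1`. -/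
theorem le_poissonWeight (hN : ∀ p, 0 < N p) (h0 : N 0 = 1)
    (hmono : Monotone (quotientSeq N)) {c β : ℝ} (hβ : 1 < β) (hc : 0 < c)
    (hg : ∀ p q : ℕ, p ≤ q →
      c * (((q : ℝ) + 1) / (p + 1)) ^ β * quotientSeq N p ≤ quotientSeq N q)
    {w : ℝ} (hw : 0 < w) : Real.pi / 4 * -Real.log (hFun N w) ≤ poissonWeight N w := by
  have hint := integrableOn_neg_log_hFun hN h0 hmono hβ hc hg hw
  have hsub : Ioc (0 : ℝ) 1 ⊆ Ioi 0 := fun u hu => hu.1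
  calc Real.pi / 4 * -Real.log (hFun N w)
      = ∫ u in Ioc (0 : ℝ) 1, -Real.log (hFun N w) * (1 + u ^ 2)⁻¹ := by
        rw [integral_const_mul, ← intervalIntegral.integral_of_le zero_le_one,
          integral_inv_one_add_sq, Real.arctan_one, Real.arctan_zero]
        ring
    _ ≤ ∫ u in Ioc (0 : ℝ) 1, -Real.log (hFun N (w * u)) * (1 + u ^ 2)⁻¹ := by
        refine setIntegral_mono_on (integrable_inv_one_add_sq.integrableOn.const_mul _)
          (hint.mono_set hsub) measurableSet_Ioc fun u hu => ?_
        have hwu : 0 < w * u := mul_pos hw hu.1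
        refine mul_le_mul_of_nonneg_right (neg_le_neg ?_) (by positivity)
        exact Real.log_le_log (hFun_pos hN hmono hβ hc hg hwu)
          (hFun_mono hN hwu.le (mul_le_of_le_one_right hw.le hu.2))
    _ ≤ poissonWeight N w := by
        refine setIntegral_mono_set hint ?_ hsub.eventuallyLE
        filter_upwards [ae_restrict_mem measurableSet_Ioi] with u hu
        exact mul_nonneg (neg_log_hFun_nonneg hN h0 (mul_pos hw hu).le) (by positivity)

theorem I_mul_ofReal_sub_ofReal_ne_zero {w : ℝ} (hw : 0 < w) (t : ℝ) :
    Complex.I * t - w ≠ 0 := fun h => by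
  have := congrArg Complex.re h
  simp at this
  exact hw.ne' this

/-- The kernel is `w + (w² - 1)/(it - w)`, and `|it - w| ≥ w`. A bound uniform in `t` makes the
Schwarz integrand integrable, so that it may be folded. -/
theorem norm_schwarzKernel_le {w : ℝ} (hw : 0 < w) (t : ℝ) :
    ‖(Complex.I * t * w - 1) / (Complex.I * t - w)‖ ≤ w + |w ^ 2 - 1| / w := by
  have hne := I_mul_ofReal_sub_ofReal_ne_zero hw t
  have h1 : (Complex.I * t * w - 1) / (Complex.I * t - w) =
      w + ((w ^ 2 - 1 : ℝ) : ℂ) / (Complex.I * t - w) := by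
    field_simp
    push_cast
    ring
  have h2 : w ≤ ‖Complex.I * t - w‖ := by
    have := Complex.abs_re_le_norm (Complex.I * t - w)
    simpa [abs_of_pos hw] using this
  rw [h1]
  refine (norm_add_le _ _).trans (add_le_add ?_ ?_)
  · rw [Complex.norm_real, Real.norm_of_nonneg hw.le]
  · rw [norm_div, Complex.norm_real, Real.norm_eq_abs]
    exact div_le_div_of_nonneg_left (abs_nonneg _) hw h2

/-- On the positive half-line the Schwarz integral reduces to the Poisson integral. -/
theorem integral_log_hFun_mul_schwarzKernel (hN : ∀ p, 0 < N p) (h0 : N 0 = 1)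
    (hmono : Monotone (quotientSeq N)) {c β : ℝ} (hβ : 1 < β) (hc : 0 < c)
    (hg : ∀ p q : ℕ, p ≤ q →
      c * (((q : ℝ) + 1) / (p + 1)) ^ β * quotientSeq N p ≤ quotientSeq N q)
    {w : ℝ} (hw : 0 < w) :
    ∫ t : ℝ, (Real.log (hFun N |t|) : ℂ) *
      ((Complex.I * t * w - 1) / (Complex.I * t - w)) * (1 / (1 + (t : ℂ) ^ 2)) =
      ((-2 * poissonWeight N w : ℝ) : ℂ) := by
  set f : ℝ → ℂ := fun t => (Real.log (hFun N |t|) : ℂ) *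
      ((Complex.I * t * w - 1) / (Complex.I * t - w)) * (1 / (1 + (t : ℂ) ^ 2)) with hf
  have hmeas : Measurable f := by
    have : Measurable fun t : ℝ => hFun N |t| := measurable_hFun.comp (by fun_prop)
    fun_prop
  have hint : Integrable f := by
    have h1 := integrableOn_neg_log_hFun hN h0 hmono hβ hc hg one_pos
    simp only [one_mul] at h1
    refine ((integrable_comp_abs h1).const_mul (w + |w ^ 2 - 1| / w)).mono'
      hmeas.aestronglyMeasurable (Filter.Eventually.of_forall fun t => ?_)
    have hφ := neg_log_hFun_nonneg hN h0 (abs_nonneg t)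
    have e1 : ‖(Real.log (hFun N |t|) : ℂ)‖ = -Real.log (hFun N |t|) := by
      rw [Complex.norm_real, ← norm_neg, Real.norm_of_nonneg hφ]
    have e2 : ‖1 / (1 + (t : ℂ) ^ 2)‖ = (1 + |t| ^ 2)⁻¹ := by
      rw [show (1 / (1 + (t : ℂ) ^ 2)) = (((1 + t ^ 2)⁻¹ : ℝ) : ℂ) by push_cast; ring,
        Complex.norm_real, Real.norm_of_nonneg (by positivity), sq_abs]
    rw [hf, norm_mul, norm_mul, e1, e2, mul_left_comm, ← mul_assoc]
    gcongr
    exact norm_schwarzKernel_le hw t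
  set F : ℝ → ℝ := fun t => Real.log (hFun N t) * (w / (t ^ 2 + w ^ 2)) with hF
  -- Folding cancels the imaginary part and produces a factor `1 + t²` that removes the weight,
  -- leaving the Poisson kernel.
  have hsum : ∀ t, f t + f (-t) = ((2 * F |t| : ℝ) : ℂ) := fun t => by
    have hne := I_mul_ofReal_sub_ofReal_ne_zero hw t
    have hne' := I_mul_ofReal_sub_ofReal_ne_zero hw (-t)
    have h1 : (1 + (t : ℂ) ^ 2) ≠ 0 := by
      have : (0 : ℝ) < 1 + t ^ 2 := by positivity
      exact_mod_cast this.ne'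
    have h2 : ((t : ℂ) ^ 2 + (w : ℂ) ^ 2) ≠ 0 := by
      have : (0 : ℝ) < t ^ 2 + w ^ 2 := by positivity
      exact_mod_cast this.ne'
    push_cast at hne'
    have h3 : (Complex.I * t * w - 1) / (Complex.I * t - w) +
        (Complex.I * -t * w - 1) / (Complex.I * -t - w) =
        2 * w * (1 + (t : ℂ) ^ 2) / ((t : ℂ) ^ 2 + (w : ℂ) ^ 2) := by
      rw [div_add_div _ _ hne hne', div_eq_div_iff (mul_ne_zero hne hne') h2]
      ring_nf
      simp only [Complex.I_sq]
      ring
    simp only [hf, hF, abs_neg, sq_abs]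
    push_cast
    rw [neg_sq, ← add_mul, ← mul_add, h3]
    field_simp
  have hdouble : (2 : ℂ) * ∫ t, f t = ((2 * (2 * ∫ t in Ioi (0 : ℝ), F t) : ℝ) : ℂ) := by
    calc (2 : ℂ) * ∫ t, f t = (∫ t, f t) + ∫ t, f (-t) := by
          rw [integral_neg_eq_self f, two_mul]
      _ = ∫ t, (f t + f (-t)) := (integral_add hint hint.comp_neg).symm
      _ = ∫ t, ((2 * F |t| : ℝ) : ℂ) := integral_congr_ae (.of_forall hsum)
      _ = _ := by rw [integral_complex_ofReal, integral_const_mul, integral_comp_abs]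
  -- Substitution `t = w u`.
  have hsubst : ∫ t in Ioi (0 : ℝ), F t = -poissonWeight N w := by
    have h1 := integral_comp_mul_left_Ioi F 0 hw
    rw [mul_zero, smul_eq_mul] at h1
    have h2 : ∫ t in Ioi (0 : ℝ), F t = w * ∫ x in Ioi (0 : ℝ), F (w * x) := by
      rw [h1, mul_inv_cancel_left₀ hw.ne']
    rw [h2, poissonWeight, ← integral_const_mul, ← integral_neg]
    congr 1 with u
    have : (0 : ℝ) < 1 + u ^ 2 := by positivity
    have : (0 : ℝ) < (w * u) ^ 2 + w ^ 2 := by positivity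
    simp only [hF]
    rw [show (w * u) ^ 2 + w ^ 2 = w ^ 2 * (1 + u ^ 2) by ring]
    field_simp
  rw [hsubst] at hdouble
  have h2 : (2 : ℂ) ≠ 0 := two_ne_zero
  apply mul_left_cancel₀ h2
  rw [hdouble]
  push_cast
  ring

end Poisson

/-! ### Two-sided bounds for `G_M` and for its moments. -/

section Moments

variable {M : ℕ → ℝ}

theorem StronglyRegular.monotone_quotientSeq (hM : StronglyRegular M) :
    Monotone (quotientSeq M) := monotone_nat_of_le_succ fun p => by
  have h := hM.logConvex (p + 1) (Nat.le_add_left 1 p)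
  rw [Nat.add_sub_cancel] at h
  unfold quotientSeq
  rw [div_le_div_iff₀ (hM.pos p) (hM.pos (p + 1))]
  nlinarith

theorem quotientSeq_rpow (hM : ∀ p, 0 < M p) (s : ℝ) (p : ℕ) :
    quotientSeq (fun p => M p ^ s) p = quotientSeq M p ^ s :=
  (Real.div_rpow (hM _).le (hM _).le s).symm

/-- The restriction of `G_M` to the positive half-line lies between two dilates of `h_M`. -/
theorem exists_hFun_le_exp_poissonWeight (hM : StronglyRegular M) {s c β : ℝ} (hs : 0 < s)
    (hβ : 1 < β) (hc : 0 < c)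
    (hg : ∀ p q : ℕ, p ≤ q → c * (((q : ℝ) + 1) / (p + 1)) ^ β *
      quotientSeq (fun p => M p ^ s) p ≤ quotientSeq (fun p => M p ^ s) q) :
    ∃ k c₁ c₂ : ℝ, 0 < k ∧ 0 < c₁ ∧ 0 < c₂ ∧ ∀ x : ℝ, 0 < x →
      k * hFun M (c₂ * x) ≤
          Real.exp (-(2 / Real.pi * poissonWeight (fun p => M p ^ s) (x ^ s))) ∧
        Real.exp (-(2 / Real.pi * poissonWeight (fun p => M p ^ s) (x ^ s))) ≤
          hFun M (c₁ * x) := by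
  obtain ⟨A, hA, hmg⟩ := hM.moderateGrowth
  set N : ℕ → ℝ := fun p => M p ^ s with hNdef
  have hN : ∀ p, 0 < N p := fun p => Real.rpow_pos_of_pos (hM.pos p) s
  have h0 : N 0 = 1 := by simp [hNdef, hM.zero]
  have hmono : Monotone (quotientSeq N) := fun p q hpq => by
    rw [quotientSeq_rpow hM.pos, quotientSeq_rpow hM.pos]
    exact Real.rpow_le_rpow (quotientSeq_pos hM.pos p).le (hM.monotone_quotientSeq hpq) hs.le
  have hπ := Real.pi_pos
  obtain ⟨K, hK, hKle⟩ := exists_poissonWeight_le hN h0 hmono hβ hc hg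
  obtain ⟨c₁, hc₁, h₁⟩ := exists_hFun_rpow_le hM.pos hM.zero hA hmg (half_pos hs)
  obtain ⟨c₂, hc₂, h₂⟩ := exists_hFun_le_rpow hM.pos hM.zero hA hmg
    (r := s * (2 / Real.pi * K)) (by positivity)
  refine ⟨Real.exp (-(2 / Real.pi * K)), c₁, c₂ * Real.exp (-1) ^ s⁻¹, Real.exp_pos _, hc₁,
    by positivity, fun x hx => ⟨?_, ?_⟩⟩
  all_goals have hxs := Real.rpow_pos_of_pos hx s
  · have hy : 0 < Real.exp (-1) ^ s⁻¹ * x := by positivity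
    -- The contraction by `1/e` in the variable `x^s` becomes one by `e^(-1/s)` in `x`.
    have e : Real.exp (-1) * x ^ s = (Real.exp (-1) ^ s⁻¹ * x) ^ s := by
      rw [Real.mul_rpow (by positivity) hx.le, Real.rpow_inv_rpow (Real.exp_pos _).le hs.ne']
    have hpos := hFun_pos hN hmono hβ hc hg (mul_pos (Real.exp_pos (-1)) hxs)
    have hle := hKle _ hxs
    have h3 : hFun N (Real.exp (-1) * x ^ s) ^ (2 / Real.pi * K) =
        hFun M (Real.exp (-1) ^ s⁻¹ * x) ^ (s * (2 / Real.pi * K)) := by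
      rw [e, hFun_rpow hM.pos hs hy, ← Real.rpow_mul (hFun_nonneg hM.pos hy.le)]
    calc Real.exp (-(2 / Real.pi * K)) * hFun M (c₂ * Real.exp (-1) ^ s⁻¹ * x)
        ≤ Real.exp (-(2 / Real.pi * K)) *
            hFun N (Real.exp (-1) * x ^ s) ^ (2 / Real.pi * K) := by
          rw [h3, mul_assoc]
          exact mul_le_mul_of_nonneg_left (h₂ _ hy.le) (Real.exp_pos _).le
      _ = Real.exp (-(2 / Real.pi *
            (K * (1 + -Real.log (hFun N (Real.exp (-1) * x ^ s)))))) := by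
          rw [Real.rpow_def_of_pos hpos, ← Real.exp_add]
          congr 1
          ring
      _ ≤ _ := by gcongr
  · have hpos := hFun_pos hN hmono hβ hc hg hxs
    have hle := le_poissonWeight hN h0 hmono hβ hc hg hxs
    calc Real.exp (-(2 / Real.pi * poissonWeight N (x ^ s)))
        ≤ Real.exp (-(2 / Real.pi * (Real.pi / 4 * -Real.log (hFun N (x ^ s))))) := by gcongr
      _ = hFun N (x ^ s) ^ (1 / 2 : ℝ) := by
          rw [Real.rpow_def_of_pos hpos]
          congr 1
          field_simp
          ring
      _ = hFun M x ^ (s / 2) := by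
          rw [hFun_rpow hM.pos hs hx, ← Real.rpow_mul (hFun_nonneg hM.pos hx.le)]
          congr 1
          ring
      _ ≤ hFun M (c₁ * x) := h₁ x hx.le

/-- The moments of a function lying between two dilates of `h_M(1 / t)` are finite and comparable to
`M`. -/
theorem exists_moment_bounds (hM : StronglyRegular M) {g : ℝ → ℝ} (hg : Measurable g)
    {k c₁ c₂ : ℝ} (hk : 0 < k) (hc₁ : 0 < c₁) (hc₂ : 0 < c₂)
    (hle : ∀ t, 0 < t → k * hFun M (c₂ * t⁻¹) ≤ g t)
    (hge : ∀ t, 0 < t → g t ≤ hFun M (c₁ * t⁻¹)) :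
    (∀ p : ℕ, IntegrableOn (fun t => t ^ p * g t) (Ioi 0)) ∧
    ∃ C₁ C₂ C₃ C₄ : ℝ, 0 < C₁ ∧ 0 < C₂ ∧ 0 < C₃ ∧ 0 < C₄ ∧ ∀ p : ℕ,
      C₃ * C₄ ^ p * M p ≤ ∫ t in Ioi (0 : ℝ), t ^ p * g t ∧
      ∫ t in Ioi (0 : ℝ), t ^ p * g t ≤ C₁ * C₂ ^ p * M p := by
  obtain ⟨A, hA, hmg⟩ := hM.moderateGrowth
  have hMp := hM.pos
  have hm := quotientSeq_pos hM.pos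
  have hg0 : ∀ t, 0 < t → 0 ≤ g t := fun t ht =>
    (mul_nonneg hk.le (hFun_nonneg hM.pos (by positivity))).trans (hle t ht)
  -- Bounding `h_M` by its terms of index `p` and `p + 2` together gains the integrable weight
  -- `1/(1+t²)`.
  set D : ℕ → ℝ := fun p => M p * c₁ ^ p + M (p + 2) * c₁ ^ (p + 2) with hD
  have hbound : ∀ (p : ℕ) (t : ℝ), 0 < t → t ^ p * g t ≤ D p * (1 + t ^ 2)⁻¹ := by
    intro p t ht
    have hct : 0 ≤ c₁ * t⁻¹ := by positivity
    have h1 := (hge t ht).trans (hFun_le hMp hct p)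
    have h2 := (hge t ht).trans (hFun_le hMp hct (p + 2))
    rw [← div_eq_mul_inv (D p), le_div_iff₀ (by positivity)]
    calc t ^ p * g t * (1 + t ^ 2) = t ^ p * g t + t ^ (p + 2) * g t := by ring
      _ ≤ t ^ p * (M p * (c₁ * t⁻¹) ^ p) + t ^ (p + 2) * (M (p + 2) * (c₁ * t⁻¹) ^ (p + 2)) := by
        gcongr
      _ = D p := by
        simp only [hD, mul_pow, inv_pow]
        field_simp
  have hint : ∀ p : ℕ, IntegrableOn (fun t => t ^ p * g t) (Ioi 0) := fun p => by
    refine (integrable_inv_one_add_sq.integrableOn.const_mul (D p)).mono'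
      (by fun_prop : Measurable fun t => t ^ p * g t).aestronglyMeasurable ?_
    filter_upwards [ae_restrict_mem measurableSet_Ioi] with t ht
    have ht0 : 0 < t := ht
    rw [Real.norm_of_nonneg (mul_nonneg (pow_pos ht0 p).le (hg0 t ht0))]
    exact hbound p t ht
  -- Moderate growth reduces `M (p + 2)` to `M p`; the base `c₁ + A c₁` dominates both `c₁` and `A
  -- c₁`.
  refine ⟨hint, Real.pi / 2 * (1 + A ^ 2 * c₁ ^ 2 * M 2), c₁ + A * c₁,
    k * c₂ * quotientSeq M 0, c₂ / 2, ?_, by positivity, ?_, by positivity, fun p => ⟨?_, ?_⟩⟩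
  · have := hMp 2
    have := Real.pi_pos
    positivity
  · have := hm 0
    positivity
  -- For `t ≤ T` the argument `c₂/t` is at least the reciprocal of the `p`-th quotient, where the
  -- infimum is attained exactly at index `p`.
  · set T := c₂ * quotientSeq M p with hT
    have hmp := hm p
    have hT0 : 0 < T := by positivity
    have hu : 0 < (quotientSeq M p)⁻¹ := inv_pos.2 hmp
    have hval : hFun M (quotientSeq M p)⁻¹ = M p * (quotientSeq M p)⁻¹ ^ p := by
      refine hFun_eq_of_quotientSeq hMp hM.monotone_quotientSeq hu (fun j hj => ?_)
        (mul_inv_cancel₀ hmp.ne').ge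
      rw [← div_eq_mul_inv, div_le_one hmp]
      exact hM.monotone_quotientSeq hj.le
    have hp2 : (p : ℝ) + 1 ≤ 2 ^ p := by exact_mod_cast Nat.lt_two_pow_self (n := p)
    calc k * c₂ * quotientSeq M 0 * (c₂ / 2) ^ p * M p
        = k * M p * c₂ * c₂ ^ p * (quotientSeq M 0 / 2 ^ p) := by rw [div_pow]; ring
      _ ≤ k * M p * c₂ * c₂ ^ p * (quotientSeq M p / (p + 1)) := by
          have := (hMp p).le
          gcongr
          exact hM.monotone_quotientSeq p.zero_le
      _ = ∫ t in Ioc 0 T, t ^ p * (k * (M p * (quotientSeq M p)⁻¹ ^ p)) := by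
          rw [integral_mul_const, ← intervalIntegral.integral_of_le hT0.le, integral_pow, hT]
          have : (p : ℝ) + 1 ≠ 0 := by positivity
          rw [inv_pow, mul_pow, zero_pow p.succ_ne_zero]
          field_simp
          ring
      _ ≤ ∫ t in Ioc 0 T, t ^ p * g t := by
          refine setIntegral_mono_on ?_ ((hint p).mono_set fun t ht => ht.1) measurableSet_Ioc
            fun t ht => ?_
          · exact (Continuous.integrableOn_Icc (by fun_prop)).mono_set Ioc_subset_Icc_self
          · have ht0 := ht.1
            refine mul_le_mul_of_nonneg_left ?_ (pow_pos ht0 p).le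
            refine le_trans ?_ (hle t ht0)
            rw [← hval]
            refine mul_le_mul_of_nonneg_left (hFun_mono hMp hu.le ?_) hk.le
            rw [← div_eq_mul_inv, le_div_iff₀ ht0, inv_mul_le_iff₀ hmp, mul_comm]
            exact ht.2
      _ ≤ ∫ t in Ioi (0 : ℝ), t ^ p * g t := by
          refine setIntegral_mono_set (hint p) ?_
            (LE.le.eventuallyLE fun t ht => ht.1)
          filter_upwards [ae_restrict_mem measurableSet_Ioi] with t ht
          exact mul_nonneg (pow_pos ht p).le (hg0 t ht)
  · have hc := hc₁.le
    have hA0 := hA.le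
    have hp := (hMp p).le
    have hM2 := (hMp 2).le
    calc ∫ t in Ioi (0 : ℝ), t ^ p * g t
        ≤ ∫ t in Ioi (0 : ℝ), D p * (1 + t ^ 2)⁻¹ :=
          setIntegral_mono_on (hint p) (integrable_inv_one_add_sq.integrableOn.const_mul (D p))
            measurableSet_Ioi fun t ht => hbound p t ht
      _ = Real.pi / 2 * D p := by
          rw [integral_const_mul, integral_Ioi_inv_one_add_sq, Real.arctan_zero]
          ring
      _ ≤ Real.pi / 2 * (M p * (c₁ + A * c₁) ^ p +
            A ^ 2 * c₁ ^ 2 * M 2 * M p * (c₁ + A * c₁) ^ p) := by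
          have hπ := Real.pi_pos.le
          have hAc := mul_nonneg hA0 hc
          refine mul_le_mul_of_nonneg_left (add_le_add ?_ ?_) (by positivity)
          · gcongr
            linarith
          · calc M (p + 2) * c₁ ^ (p + 2)
                ≤ (A ^ (p + 2) * M p * M 2) * c₁ ^ (p + 2) := by gcongr; exact hmg p 2
              _ = A ^ 2 * c₁ ^ 2 * M 2 * M p * (A * c₁) ^ p := by ring
              _ ≤ _ := by gcongr; linarith
      _ = _ := by ring

theorem flatG_of_rpow_eq (hM : StronglyRegular M) {s c β w : ℝ} (hs : 0 < s)
    (hβ : 1 < β) (hc : 0 < c)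
    (hg : ∀ p q : ℕ, p ≤ q → c * (((q : ℝ) + 1) / (p + 1)) ^ β *
      quotientSeq (fun p => M p ^ s) p ≤ quotientSeq (fun p => M p ^ s) q)
    (hw : 0 < w) {z : LogSurface} (hz : z.rpow s = w) :
    flatG M s z =
      (Real.exp (-(2 / Real.pi * poissonWeight (fun p => M p ^ s) w)) : ℂ) := by
  have hmono : Monotone (quotientSeq fun p => M p ^ s) := fun p q hpq => by
    rw [quotientSeq_rpow hM.pos, quotientSeq_rpow hM.pos]
    exact Real.rpow_le_rpow (quotientSeq_pos hM.pos p).le (hM.monotone_quotientSeq hpq) hs.le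
  rw [flatG, hz, integral_log_hFun_mul_schwarzKernel
    (fun p => Real.rpow_pos_of_pos (hM.pos p) s) (by simp [hM.zero]) hmono hβ hc hg hw]
  push_cast
  congr 1
  ring

theorem LogSurface.rpow_inv_ofPos {t : ℝ} (ht : 0 < t) (s : ℝ) :
    (LogSurface.ofPos t).inv.rpow s = ((t⁻¹ ^ s : ℝ) : ℂ) := by
  rw [Real.rpow_def_of_pos (inv_pos.2 ht), Real.log_inv]
  simp only [LogSurface.rpow, LogSurface.inv, LogSurface.ofPos]
  push_cast
  congr 1
  ring

theorem LogSurface.toComplex_ofPos {t : ℝ} (ht : 0 < t) : (LogSurface.ofPos t).toComplex = t := by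
  rw [LogSurface.toComplex, LogSurface.ofPos, ← Complex.ofReal_exp, Real.exp_log ht]

end Moments

theorem mainTheorem4 (M : ℕ → ℝ) (hM : StronglyRegular M) (δ δ₁ s : ℝ)
    (hδ : 0 < δ) (hδδ₁ : δ < δ₁) (hδ₁ : δ₁ < growthIndex M)
    (hsδ₁ : s * δ₁ < 1) (hs : 1 < s * growthIndex M) :
    ∃ m : ℕ → ℝ,
      (∀ p : ℕ,
        MeasureTheory.IntegrableOn (momentIntegrand M s (p : ℂ)) (Set.Ioi (0 : ℝ)) ∧
        momentFun M s (p : ℂ) = (m p : ℂ) ∧ 0 < m p) ∧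
      (∃ L H : ℝ, 0 < L ∧ 0 < H ∧
        ∀ p : ℕ, 1 ≤ p → L ^ p * M p ≤ m p ∧ m p ≤ H ^ p * M p) ∧
      (∃ C₁ C₂ C₃ C₄ : ℝ, 0 < C₁ ∧ 0 < C₂ ∧ 0 < C₃ ∧ 0 < C₄ ∧
        ∀ p : ℕ, C₃ * C₄ ^ p * M p ≤ m p ∧ m p ≤ C₁ * C₂ ^ p * M p) := by
  have hγ0 : 0 < growthIndex M := hδ.trans (hδδ₁.trans hδ₁)
  have hs0 : 0 < s := pos_of_mul_pos_left (zero_lt_one.trans hs) hγ0.le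
  -- The default value `sSup ∅ = 0` would contradict the positive index.
  have hne : {γ : ℝ | PropertyP M γ}.Nonempty := by
    by_contra h
    rw [not_nonempty_iff_eq_empty] at h
    rw [growthIndex, h, Real.sSup_empty] at hγ0
    exact lt_irrefl _ hγ0
  obtain ⟨γ, hγ, hγs⟩ := exists_lt_of_lt_csSup hne
    (show 1 / s < sSup {γ : ℝ | PropertyP M γ} by
      rw [div_lt_iff₀ hs0, mul_comm]; exact hs)
  rw [div_lt_iff₀ hs0] at hγs
  -- Raising this growth to the power `s` gives the exponent `β = γ s > 1` for `M^s`.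
  obtain ⟨c, hc, hcg⟩ := PropertyP.exists_quotientSeq_le hM.pos hM.monotone_quotientSeq hγ
  have hg : ∀ p q : ℕ, p ≤ q → c ^ s * (((q : ℝ) + 1) / (p + 1)) ^ (γ * s) *
      quotientSeq (fun p => M p ^ s) p ≤ quotientSeq (fun p => M p ^ s) q := fun p q hpq => by
    have hmp := (quotientSeq_pos hM.pos p).le
    rw [quotientSeq_rpow hM.pos, quotientSeq_rpow hM.pos, Real.rpow_mul (by positivity),
      ← Real.mul_rpow hc.le (by positivity), ← Real.mul_rpow (by positivity) hmp]
    exact Real.rpow_le_rpow (by positivity) (hcg p q hpq) hs0.le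
  have hcs := Real.rpow_pos_of_pos hc s
  obtain ⟨k, c₁, c₂, hk, hc₁, hc₂, hbd⟩ :=
    exists_hFun_le_exp_poissonWeight hM hs0 hγs hcs hg
  set g : ℝ → ℝ := fun t =>
    Real.exp (-(2 / Real.pi * poissonWeight (fun p => M p ^ s) (t⁻¹ ^ s))) with hgdef
  have hgm : Measurable g := by
    have : Measurable fun t : ℝ => poissonWeight (fun p => M p ^ s) (t⁻¹ ^ s) :=
      measurable_poissonWeight.comp (by fun_prop)
    fun_prop
  obtain ⟨hint, C₁, C₂, C₃, C₄, hC₁, hC₂, hC₃, hC₄, hC⟩ := exists_moment_bounds hM hgm hk hc₁ hc₂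
    (fun t ht => (hbd _ (inv_pos.2 ht)).1) (fun t ht => (hbd _ (inv_pos.2 ht)).2)
  have hpt : ∀ p : ℕ, EqOn (fun t : ℝ => ((t ^ p * g t : ℝ) : ℂ)) (momentIntegrand M s (p : ℂ))
      (Ioi 0) := fun p t ht => by
    have ht0 : 0 < t := ht
    have htc : (t : ℂ) ≠ 0 := by exact_mod_cast ht0.ne'
    simp only [momentIntegrand, kernelE]
    rw [flatG_of_rpow_eq hM hs0 hγs hcs hg (Real.rpow_pos_of_pos (inv_pos.2 ht0) s)
      (LogSurface.rpow_inv_ofPos ht0 s), LogSurface.toComplex_ofPos ht0,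
      Complex.cpow_sub _ _ htc, Complex.cpow_one, Complex.cpow_natCast, ← mul_assoc,
      div_mul_cancel₀ _ htc]
    exact Complex.ofReal_mul _ _ |>.trans (by rw [Complex.ofReal_pow])
  -- For `p ≥ 1` the prefactors go into the base: `(min C₃ 1)^p ≤ C₃` and `C₁ ≤ (max C₁ 1)^p`.
  refine ⟨fun p => ∫ t in Ioi (0 : ℝ), t ^ p * g t, fun p => ⟨?_, ?_, ?_⟩,
    ⟨min C₃ 1 * C₄, max C₁ 1 * C₂, by positivity, by positivity, fun p hp => ?_⟩,
    C₁, C₂, C₃, C₄, hC₁, hC₂, hC₃, hC₄, hC⟩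
  · exact IntegrableOn.congr_fun (hint p).ofReal (hpt p) measurableSet_Ioi
  · rw [momentFun, ← setIntegral_congr_fun measurableSet_Ioi (hpt p), integral_complex_ofReal]
  · have := hM.pos p
    exact lt_of_lt_of_le (by positivity) (hC p).1
  · have hMp := (hM.pos p).le
    have hp0 : p ≠ 0 := Nat.one_le_iff_ne_zero.1 hp
    refine ⟨le_trans ?_ (hC p).1, (hC p).2.trans ?_⟩
    · rw [mul_pow]
      gcongr
      exact (pow_le_of_le_one (by positivity) (min_le_right _ _) hp0).trans (min_le_left _ _)
    · rw [mul_pow]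
      gcongr
      exact (le_max_left _ _).trans (le_self_pow₀ (le_max_right _ _) hp0)
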